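/- Let $\mathbb X$ be a locally compact separable metric space with its Borel $\sigma$-algebra and let $\sigma$ be a $\sigma$-finite non-atomic Borel measure on $\mathbb X$. Let $\Omega$ be the space of configurations, i.e. of locally finite subsets $\omega\subset\mathbb X$, each identified with the measure $\sum_{y\in\omega}\delta_y$, with the smallest $\sigma$-algebra that makes $\omega\mapsto\omega(A)$ measurable for all Borel $A\subset\mathbb X$. Let $\mathbb P$ be a Poisson probability measure on $\Omega$ with intensity $\sigma$: for every Borel set $A$ the variable $\omega(A)$ has the Poisson distribution with mean $\sigma(A)$ (and $\omega(A)=\infty$ almost surely if $\sigma(A)=\infty$), and $\omega(A_1),\dots,\omega(A_m)$ are independent whenever $A_1,\dots,A_m$ are pairwise disjoint Borel sets. Let $\mathbb E$ be the expectation under $\mathbb P$. A nonnegative $k$-process is a jointly measurable map $f:\mathbb X^k\times\Omega\to[0,\infty)$; for $k=0$ it is a random variable on $\Omega$. Put $\omega_1=\omega$ and $\omega_0=\sigma$, and for $\epsilon\in\{0,1\}^k$ let $\omega_\epsilon(dx)=\omega_{\epsilon_1}(dx_1)\cdots\omega_{\epsilon_k}(dx_k)$ be the product measure on $\mathbb X^k$.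 Let $l\ge 1$ and $r_1,n_1,\dots,r_l,n_l\ge 1$ be integers, let $f_0\ge 0$ be a random variable, let $f_1,\dots,f_l\ge0$ be $r_1$-, …, $r_l$-processes, respectively, and let $\epsilon_{(1)}\in\{0,1\}^{r_1},\dots,\epsilon_{(l)}\in\{0,1\}^{r_l}$. Let $$S=\{(\alpha,\beta,\gamma):1\le\alpha\le l,\ 1\le\beta\le r_\alpha,\ 1\le\gamma\le n_\alpha\},\qquad S_{\alpha,\gamma}=\{(\alpha,\beta,\gamma):1\le\beta\le r_\alpha\},$$ and let $\epsilon_s=\epsilon_{(\alpha)}(\beta)$ for $s=(\alpha,\beta,\gamma)\in S$. Let $\mathcal P^\epsilon(S)$ be the set of all partitions $P=\{P_1,\dots,P_k\}$ of $S$ into nonempty blocks such that $\epsilon_s=1$ for every $s$ that lies in a block with more than one element. For such $P$ and $y\in\mathbb X^k$ define $y^P\in\mathbb X^S$ by $y^P_s=y_i$ if $s\in P_i$, and let $y^P_{S_{\alpha,\gamma}}=(y^P_{(\alpha,1,\gamma)},\dots,y^P_{(\alpha,r_\alpha,\gamma)})$. Let $\mathbb X^k_{\ne}$ be the set of all $y\in\mathbb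 X^k$ with pairwise different coordinates and let $\sigma^k(dy)=\sigma(dy_1)\cdots\sigma(dy_k)$. Then, as an equality in $[0,\infty]$, $$\mathbb E\Bigl[f_0(\omega)\prod_{\alpha=1}^l\Bigl(\int_{\mathbb X^{r_\alpha}}f_\alpha(y;\omega)\,\omega_{\epsilon_{(\alpha)}}(dy)\Bigr)^{n_\alpha}\Bigr] =\sum_{P=\{P_1,\dots,P_k\}\in\mathcal P^\epsilon(S)}\mathbb E\Bigl[\int_{\mathbb X^k_{\ne}}f_0\bigl(\omega\cup\{y^P_s:\epsilon_s=1\}\bigr)\prod_{\alpha=1}^l\prod_{\gamma=1}^{n_\alpha}f_\alpha\bigl(y^P_{S_{\alpha,\gamma}};\omega\cup\{y^P_s:\epsilon_s=1\}\bigr)\,\sigma^k(dy)\Bigr].$$ -/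

import Mathlib

open MeasureTheory ProbabilityTheory
open scoped ENNReal NNReal

/-- A configuration on `X`: a locally finite subset of `X`, i.e. a set which has only finitely many
points in every compact set. -/
@[ext]
structure PointConfig (X : Type*) [TopologicalSpace X] where
  /-- the underlying set of points -/
  carrier : Set X
  /-- local finiteness -/
  finite_inter : ∀ K : Set X, IsCompact K → (carrier ∩ K).Finite

namespace PointConfig

variable {X : Type*} [TopologicalSpace X]

/-- The measure `∑_{x ∈ ω} δ_x` identified with the configuration `ω`. -/
noncomputable def toMeasure [MeasurableSpace X] (ω : PointConfig X) : Measure X :=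
  Measure.sum (fun x : ω.carrier => Measure.dirac (x : X))

/-- The smallest σ-algebra on the configuration space that makes all the maps `ω ↦ ω(A)`,
with `A` a measurable set, measurable. -/
noncomputable instance instMeasurableSpace [MeasurableSpace X] : MeasurableSpace (PointConfig X) :=
  ⨆ (A : Set X) (_ : MeasurableSet A),
    MeasurableSpace.comap (fun ω : PointConfig X => ω.toMeasure A) inferInstance

/-- The configuration `ω ∪ F`, where `F` is a finite set of points. -/
def unionFinite (ω : PointConfig X) (F : Set X) (hF : F.Finite) : PointConfig X where
  carrier := ω.carrier ∪ F
  finite_inter K hK := by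
    rw [Set.union_inter_distrib_right]
    exact (ω.finite_inter K hK).union (hF.subset Set.inter_subset_left)

end PointConfig

/-- The Poisson distribution with mean `m ∈ [0, ∞]`, as a measure on `[0, ∞]`; for `m = ∞` it is
concentrated at `∞`. -/
noncomputable def extPoisson (m : ℝ≥0∞) : Measure ℝ≥0∞ :=
  if m = ∞ then Measure.dirac ∞
  else (poissonMeasure m.toNNReal).map (fun n : ℕ => (n : ℝ≥0∞))

/-- `Pr` is a Poisson probability measure on the configuration space with intensity measure `σ`:
under `Pr`, the random measure `N(A, ω) = ω(A)` is a Poisson random measure with intensity `σ`. -/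
structure IsPoissonMeasure {X : Type*} [TopologicalSpace X] [MeasurableSpace X]
    (σ : Measure X) (Pr : Measure (PointConfig X)) : Prop where
  isProbabilityMeasure : IsProbabilityMeasure Pr
  law : ∀ A : Set X, MeasurableSet A →
    Pr.map (fun ω : PointConfig X => ω.toMeasure A) = extPoisson (σ A)
  indep : ∀ (m : ℕ) (A : Fin m → Set X), (∀ i, MeasurableSet (A i)) →
    (∀ i j, i ≠ j → Disjoint (A i) (A j)) →
    iIndepFun (fun i (ω : PointConfig X) => ω.toMeasure (A i)) Pr

/-- A nonnegative `k`-process: a jointly measurable map `X^k × Ω → [0, ∞)`. -/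
def IsProcess {X : Type*} [TopologicalSpace X] [MeasurableSpace X] {k : ℕ}
    (f : (Fin k → X) → PointConfig X → ℝ≥0) : Prop :=
  Measurable (fun p : (Fin k → X) × PointConfig X => f p.1 p.2)

/-- `ω_1 = ω` and `ω_0 = σ`. -/
noncomputable def mixedMeasure {X : Type*} [TopologicalSpace X] [MeasurableSpace X]
    (σ : Measure X) (ω : PointConfig X) (e : Fin 2) : Measure X :=
  if e = 1 then ω.toMeasure else σ

/-- The product measure `ω_ε(dx) = ω_{ε_1}(dx_1) ⋯ ω_{ε_k}(dx_k)` on `X^k`. -/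
noncomputable def mixedProd {X : Type*} [TopologicalSpace X] [MeasurableSpace X]
    (σ : Measure X) (ω : PointConfig X) {k : ℕ} (ε : Fin k → Fin 2) : Measure (Fin k → X) :=
  Measure.pi (fun i => mixedMeasure σ ω (ε i))

/-- The index set `S` of all triples `(α, β, γ)` with `α < l`, `β < r α`, `γ < n α`
(counting from zero). -/
abbrev MomentIndex {l : ℕ} (r n : Fin l → ℕ) : Type :=
  (α : Fin l) × (Fin (r α) × Fin (n α))

/-- The map `ε : S → {0, 1}` with `ε_s = ε_(α)(β)` for `s = (α, β, γ)`. -/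
def momentPattern {l : ℕ} {r n : Fin l → ℕ} (ε : (α : Fin l) → Fin (r α) → Fin 2) :
    MomentIndex r n → Fin 2 :=
  fun s => ε s.1 s.2.1

/-- The set `𝒫^ε(S)` of the partitions of `S` such that `ε = 1` at all points of every block with
more than one element. -/
def mixedPartitions {S : Type} [Fintype S] [DecidableEq S] (ε : S → Fin 2) :
    Finset (Finpartition (Finset.univ : Finset S)) :=
  Finset.univ.filter (fun P => ∀ B ∈ P.parts, 1 < B.card → ∀ s ∈ B, ε s = 1)

/-- The point `y^P ∈ X^S`: `y^P_s = y_B` if `s` is in the block `B` of `P`. The coordinates of `y`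
are indexed by the blocks of `P`. -/
def partitionPoint {S : Type} [Fintype S] [DecidableEq S] {X : Type*}
    (P : Finpartition (Finset.univ : Finset S)) (y : P.parts → X) : S → X :=
  fun s => y ⟨P.part s, P.part_mem.mpr (Finset.mem_univ s)⟩

/-- The configuration `ω ∪ {z_s : ε_s = 1}`. -/
def PointConfig.adjoin {X : Type*} [TopologicalSpace X] {S : Type} [Finite S]
    (ω : PointConfig X) (ε : S → Fin 2) (z : S → X) : PointConfig X :=
  ω.unionFinite (z '' {s | ε s = 1}) (Set.toFinite _)

/-!
The proof has three ingredients.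

*Mecke's formula* `IsPoissonMeasure.mecke`: `E ∫ G(ω, x) ω(dx) = E ∫ G(ω ∪ {x}, x) σ(dx)`. Both
sides are integrals of `G` with respect to measures on `Ω × X`. By a π-system argument it suffices
to compare these on `C × A`, where `σ A < ∞` and `C` prescribes the numbers of points in finitely many
sets. These sets and `A` generate a finite partition of `X`, the numbers of points in its classes
are independent Poisson variables, and the claim becomes the identity `E[N g(N)] = m E[g(N + 1)]`
for a Poisson variable `N` with mean `m`. Here a given point `x` almost surely does not belong to
`ω`, because `σ` has no atoms.

*Mixed Mecke formula* `IsPoissonMeasure.mecke_mixed_fin`: on the tuples with pairwise different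
coordinates, integration against `ω_e` may be replaced by integration against a power of `σ` if the
points with `e = 1` are added to `ω`. This is an induction on the number of coordinates, which
treats one coordinate at a time, by Mecke's formula or by Tonelli's theorem. Since the remaining
coordinates avoid the point `x` already added, their product measures built from `ω ∪ {x}` and
from `ω` agree.

*Diagonals* `setLIntegral_pi_mixedMeasure_fibers`: the product of the powers of integrals is a
single integral over `X^S`, and `X^S` is the disjoint union over all partitions `P` of `S` of
the sets of tuples whose level sets are the blocks of `P`. If a block with at least two elements contains an `s`
with `ε s = 0`, the set is null, as `σ` has no atoms. Otherwise `ω_ε` on this set is the image of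
the mixed product measure indexed by the blocks, restricted to tuples with pairwise different
coordinates, because the atoms of `ω` have mass one.
`IsPoissonMeasure.lintegral_pi_mixedMeasure` combines the three ingredients.
-/

universe u

/-! ### The space of configurations -/

namespace PointConfig

section Basic

variable {X : Type*} [TopologicalSpace X]

/-- The configuration `ω ∪ {x}`. -/
def addPoint (ω : PointConfig X) (x : X) : PointConfig X :=
  ω.unionFinite {x} (Set.finite_singleton x)

theorem carrier_addPoint (ω : PointConfig X) (x : X) :
    (ω.addPoint x).carrier = ω.carrier ∪ {x} := rfl

variable [MeasurableSpace X]

theorem toMeasure_apply (ω : PointConfig X) {A : Set X} (hA : MeasurableSet A) :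
    ω.toMeasure A = ((ω.carrier ∩ A).encard : ℝ≥0∞) := by
  rw [toMeasure, Measure.sum_apply _ hA, ← ENNReal.tsum_set_one,
    tsum_subtype (ω.carrier ∩ A) (fun _ => (1 : ℝ≥0∞))]
  simp_rw [Measure.dirac_apply' _ hA]
  rw [tsum_subtype ω.carrier (A.indicator (1 : X → ℝ≥0∞)), ← Set.indicator_indicator]
  rfl

theorem toMeasure_singleton [MeasurableSingletonClass X] (ω : PointConfig X) (x : X) :
    ω.toMeasure {x} = ω.carrier.indicator 1 x := by
  rw [toMeasure_apply _ (measurableSet_singleton x)]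
  by_cases hx : x ∈ ω.carrier
  · rw [Set.inter_eq_right.2 (Set.singleton_subset_iff.2 hx)]
    simp [hx]
  · rw [Set.inter_singleton_eq_empty.2 hx]
    simp [hx]

/-- The mass `1 - ω({x})` of the added point vanishes if `x` already belongs to `ω`. -/
theorem toMeasure_addPoint [MeasurableSingletonClass X] (ω : PointConfig X) (x : X) {A : Set X}
    (hA : MeasurableSet A) :
    (ω.addPoint x).toMeasure A
      = ω.toMeasure A + A.indicator (fun _ => 1 - ω.toMeasure {x}) x := by
  rw [toMeasure_apply _ hA, toMeasure_apply _ hA, toMeasure_singleton, carrier_addPoint]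
  by_cases hA' : x ∈ A
  · by_cases hx : x ∈ ω.carrier
    · rw [Set.union_eq_left.2 (Set.singleton_subset_iff.2 hx)]
      simp [hx, hA']
    · rw [Set.union_inter_distrib_right, Set.singleton_inter_of_mem hA',
        Set.encard_union_eq (by simp [hx])]
      simp [hx, hA']
  · rw [Set.union_inter_distrib_right, Set.singleton_inter_eq_empty.2 hA']
    simp [hA']

/-- Adding the point `x` does not change the configuration away from `x`. -/
theorem restrict_toMeasure_addPoint [MeasurableSingletonClass X] (ω : PointConfig X) (x : X) :
    (ω.addPoint x).toMeasure.restrict {x}ᶜ = ω.toMeasure.restrict {x}ᶜ := by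
  ext A hA
  rw [Measure.restrict_apply hA, Measure.restrict_apply hA,
    toMeasure_addPoint _ _ (hA.inter (measurableSet_singleton x).compl)]
  simp

theorem measurable_toMeasure_apply {A : Set X} (hA : MeasurableSet A) :
    Measurable fun ω : PointConfig X => ω.toMeasure A :=
  Measurable.mono (comap_measurable _) (le_iSup₂_of_le A hA le_rfl) le_rfl

theorem measurable_toMeasure : Measurable (toMeasure : PointConfig X → Measure X) :=
  Measure.measurable_of_measurable_coe _ fun _ hA => measurable_toMeasure_apply hA

theorem measurable_iff_toMeasure {A : Type*} [MeasurableSpace A] {g : A → PointConfig X} :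
    Measurable g ↔ ∀ B : Set X, MeasurableSet B → Measurable fun a => (g a).toMeasure B := by
  refine ⟨fun h B hB => (measurable_toMeasure_apply hB).comp h, fun h => ?_⟩
  refine measurable_iff_comap_le.2 ?_
  simp only [instMeasurableSpace, MeasurableSpace.comap_iSup, MeasurableSpace.comap_comp]
  exact iSup₂_le fun B hB => (h B hB).comap_le

/-- The configuration as a kernel from the configuration space to the ground space. -/
noncomputable def kernel : Kernel (PointConfig X) X where
  toFun := toMeasure
  measurable' := measurable_toMeasure

end Basic

section Polish

variable {X : Type*} [MetricSpace X] [LocallyCompactSpace X] [SecondCountableTopology X]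

theorem countable_carrier (ω : PointConfig X) : ω.carrier.Countable := by
  have h : ω.carrier = ⋃ n, ω.carrier ∩ compactCovering X n := by
    rw [← Set.inter_iUnion, iUnion_compactCovering, Set.inter_univ]
  rw [h]
  exact Set.countable_iUnion fun n => (ω.finite_inter _ (isCompact_compactCovering X n)).countable

variable [MeasurableSpace X] [BorelSpace X]

theorem toMeasure_compl_carrier (ω : PointConfig X) : ω.toMeasure ω.carrierᶜ = 0 := by
  rw [toMeasure_apply _ ω.countable_carrier.measurableSet.compl]
  simp

instance instIsFiniteMeasureOnCompacts (ω : PointConfig X) :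
    IsFiniteMeasureOnCompacts ω.toMeasure where
  lt_top_of_isCompact K hK := by
    rw [toMeasure_apply _ hK.measurableSet]
    simpa using (ω.finite_inter K hK)

/-- The kernel is the countable sum of its restrictions to the pieces of a compact exhaustion and
to the configurations with a given number of points in such a piece; each of these is a finite
kernel. -/
instance instIsSFiniteKernel : IsSFiniteKernel (kernel (X := X)) := by
  classical
  let K : ℕ → Set X := disjointed (compactCovering X)
  have hK : ∀ n, MeasurableSet (K n) := fun n =>
    MeasurableSet.disjointed (fun i => (isCompact_compactCovering X i).measurableSet) n
  have hfin : ∀ n (ω : PointConfig X), ω.toMeasure (K n) < ∞ := fun n ω =>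
    (measure_mono (disjointed_subset _ n)).trans_lt (isCompact_compactCovering X n).measure_lt_top
  let s : ℕ → ℕ → Set (PointConfig X) := fun n m => {ω | ω.toMeasure (K n) = m}
  have hs : ∀ n m, MeasurableSet (s n m) := fun n m =>
    measurable_toMeasure_apply (hK n) (measurableSet_singleton _)
  have key : kernel (X := X) = Kernel.sum fun p : ℕ × ℕ =>
      Kernel.piecewise (hs p.1 p.2) (kernel.restrict (hK p.1)) 0 := by
    ext ω A hA
    rw [Kernel.sum_apply' _ _ hA, ENNReal.tsum_prod (f := fun n m =>
      Kernel.piecewise (hs n m) (kernel.restrict (hK n)) 0 ω A)]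
    have h1 : ∀ n, ∑' m, Kernel.piecewise (hs n m) (kernel.restrict (hK n)) 0 ω A
        = ω.toMeasure (A ∩ K n) := by
      intro n
      obtain ⟨m, hm⟩ : ∃ m : ℕ, ω.toMeasure (K n) = m := by
        have := hfin n ω
        rw [toMeasure_apply _ (hK n)] at this ⊢
        have h3 : (ω.carrier ∩ K n).Finite := by simpa using this
        exact ⟨h3.toFinset.card, by rw [h3.encard_eq_coe_toFinset_card]; simp⟩
      rw [tsum_eq_single m]
      · rw [Kernel.piecewise_apply, if_pos (show ω ∈ s n m from hm), Kernel.restrict_apply,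
          Measure.restrict_apply hA]
        rfl
      · intro m' hm'
        rw [Kernel.piecewise_apply, if_neg]
        · rfl
        · intro h
          exact hm' (by exact_mod_cast (show (m' : ℝ≥0∞) = m from (h.symm.trans hm)))
    simp_rw [h1]
    rw [← measure_iUnion (fun i j hij => ((disjoint_disjointed _ hij).mono
        Set.inter_subset_right Set.inter_subset_right)) (fun n => hA.inter (hK n)),
      ← Set.inter_iUnion, iUnion_disjointed, iUnion_compactCovering, Set.inter_univ]
    rfl
  rw [key]
  have : ∀ p : ℕ × ℕ, IsSFiniteKernel
      (Kernel.piecewise (hs p.1 p.2) ((kernel (X := X)).restrict (hK p.1)) 0) := by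
    intro p
    have : IsFiniteKernel
      (Kernel.piecewise (hs p.1 p.2) ((kernel (X := X)).restrict (hK p.1)) 0) := by
      refine ⟨p.2, by simp, fun ω => ?_⟩
      rw [Kernel.piecewise_apply]
      split_ifs with h
      · rw [Kernel.restrict_apply, Measure.restrict_apply_univ]
        exact (show ω.toMeasure (K p.1) = p.2 from h).le
      · simp
    infer_instance
  infer_instance

theorem measurable_toMeasure_singleton :
    Measurable fun p : PointConfig X × X => p.1.toMeasure {p.2} := by
  have h : ∀ p : PointConfig X × X, p.1.toMeasure {p.2} =
      ∫⁻ y, ({q : X × X | q.1 = q.2}).indicator 1 (p.2, y) ∂(kernel.prodMkRight X p) := by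
    intro p
    rw [Kernel.prodMkRight_apply]
    change _ = ∫⁻ y, ({y | p.2 = y} : Set X).indicator 1 y ∂p.1.toMeasure
    have : ({y | p.2 = y} : Set X) = {p.2} := by ext; simp [eq_comm]
    rw [this, lintegral_indicator_one (measurableSet_singleton _)]
  simp_rw [h]
  refine Measurable.lintegral_kernel_prod_right ?_
  have hd : MeasurableSet {q : X × X | q.1 = q.2} :=
    measurableSet_eq_fun measurable_fst measurable_snd
  exact (measurable_one.indicator hd).comp
    (f := fun z : (PointConfig X × X) × X => (z.1.2, z.2)) (by fun_prop)

theorem measurable_addPoint : Measurable fun p : PointConfig X × X => p.1.addPoint p.2 := by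
  refine measurable_iff_toMeasure.2 fun B hB => ?_
  simp_rw [toMeasure_addPoint _ _ hB]
  refine ((measurable_toMeasure_apply hB).comp measurable_fst).add ?_
  have : (fun p : PointConfig X × X => B.indicator (fun _ => 1 - p.1.toMeasure {p.2}) p.2)
      = (Prod.snd ⁻¹' B).indicator fun p : PointConfig X × X => 1 - p.1.toMeasure {p.2} := by
    ext p
    rfl
  rw [this]
  exact (measurable_const.sub measurable_toMeasure_singleton).indicator (measurable_snd hB)

end Polish

end PointConfig

/-! ### Counts of points are independent Poisson variables -/

instance instIsProbabilityMeasureExtPoisson (m : ℝ≥0∞) : IsProbabilityMeasure (extPoisson m) := by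
  rw [extPoisson]
  split_ifs
  · infer_instance
  · exact Measure.isProbabilityMeasure_map measurable_from_nat.aemeasurable

/-- The Chen–Stein identity, which characterizes the Poisson distribution:
`E[N g(N)] = m E[g(N + 1)]` for `N` Poisson distributed with mean `m`. -/
theorem lintegral_mul_extPoisson {m : ℝ≥0∞} (hm : m ≠ ∞) {g : ℝ≥0∞ → ℝ≥0∞} (hg : Measurable g) :
    ∫⁻ t, t * g t ∂extPoisson m = m * ∫⁻ t, g (t + 1) ∂extPoisson m := by
  lift m to ℝ≥0 using hm
  rw [extPoisson, if_neg ENNReal.coe_ne_top, ENNReal.toNNReal_coe,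
    lintegral_map (f := fun t => t * g t) (measurable_id.mul hg) measurable_from_nat,
    lintegral_map (f := fun t => g (t + 1)) (hg.comp (measurable_id.add_const 1))
      measurable_from_nat,
    lintegral_countable', lintegral_countable', tsum_eq_zero_add' ENNReal.summable,
    ← ENNReal.tsum_mul_left]
  simp only [Nat.cast_zero, zero_mul, zero_add, poissonMeasure_singleton]
  refine tsum_congr fun n => ?_
  have h : ENNReal.ofReal (Real.exp (-m) * m ^ (n + 1) / (n + 1).factorial) * ((n + 1 : ℕ) : ℝ≥0∞)
      = m * ENNReal.ofReal (Real.exp (-m) * m ^ n / n.factorial) := by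
    rw [← ENNReal.ofReal_natCast, ← ENNReal.ofReal_coe_nnreal, ← ENNReal.ofReal_mul (by positivity),
      ← ENNReal.ofReal_mul (by positivity)]
    congr 1
    rw [Nat.factorial_succ]
    push_cast
    field_simp
    ring
  rw [mul_right_comm, mul_comm _ (ENNReal.ofReal _), h]
  push_cast
  ring

namespace IsPoissonMeasure

variable {X : Type*} [TopologicalSpace X] [MeasurableSpace X] {σ : Measure X}
  {Pr : Measure (PointConfig X)}

theorem lintegral_toMeasure (hPr : IsPoissonMeasure σ Pr) {A : Set X} (hA : MeasurableSet A)
    (hσA : σ A ≠ ∞) : ∫⁻ ω, ω.toMeasure A ∂Pr = σ A := by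
  have h := lintegral_mul_extPoisson hσA (measurable_const (a := 1))
  rw [← hPr.law A hA,
    lintegral_map (by fun_prop) (PointConfig.measurable_toMeasure_apply hA)] at h
  rw [hPr.law A hA] at h
  simpa using h

theorem ae_toMeasure_singleton [MeasurableSingletonClass X] [NullSingletonClass σ]
    (hPr : IsPoissonMeasure σ Pr) (x : X) :
    ∀ᵐ ω ∂Pr, ω.toMeasure {x} = 0 := by
  have h := hPr.lintegral_toMeasure (measurableSet_singleton x) (by simp)
  rw [measure_singleton,
    lintegral_eq_zero_iff (PointConfig.measurable_toMeasure_apply (measurableSet_singleton x))] at h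
  exact h

/-- The numbers of points in the classes of a finite measurable partition of `X`, here the fibres of
`c`, are independent Poisson variables. -/
theorem map_fiber_counts (hPr : IsPoissonMeasure σ Pr) {J : Type*} [Fintype J] [MeasurableSpace J]
    [DiscreteMeasurableSpace J] {c : X → J} (hc : Measurable c) :
    Pr.map (fun ω j => ω.toMeasure (c ⁻¹' {j})) =
      Measure.pi fun j => extPoisson (σ (c ⁻¹' {j})) := by
  have := hPr.isProbabilityMeasure
  have hm : ∀ j, MeasurableSet (c ⁻¹' {j}) := fun j => hc (.of_discrete)
  let e := Fintype.equivFin J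
  have h1 := hPr.indep (Fintype.card J) (fun i => c ⁻¹' {e.symm i}) (fun i => hm _)
    (fun i j hij => Disjoint.preimage _ (by simpa using hij))
  have h2 := h1.precomp e.injective
  have h3 : iIndepFun (fun j (ω : PointConfig X) => ω.toMeasure (c ⁻¹' {j})) Pr := by
    convert h2 using 2 with j
    ext ω
    simp [e]
  rw [(iIndepFun_iff_map_fun_eq_pi_map
    (fun j => (PointConfig.measurable_toMeasure_apply (hm j)).aemeasurable)).1 h3]
  congr 1
  ext1 j
  exact hPr.law _ (hm j)

/-- The Chen–Stein identity for one of the independent numbers of points in the fibres of `c`, the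
others being fixed. -/
theorem lintegral_mul_fiber_counts (hPr : IsPoissonMeasure σ Pr) {J : Type*} [Fintype J]
    [DecidableEq J] [MeasurableSpace J] [DiscreteMeasurableSpace J] {c : X → J} (hc : Measurable c)
    (j : J) (hj : σ (c ⁻¹' {j}) ≠ ∞) {Φ : (J → ℝ≥0∞) → ℝ≥0∞} (hΦ : Measurable Φ) :
    ∫⁻ ω, ω.toMeasure (c ⁻¹' {j}) * Φ (fun i => ω.toMeasure (c ⁻¹' {i})) ∂Pr =
      σ (c ⁻¹' {j}) *
        ∫⁻ ω, Φ ((fun i => ω.toMeasure (c ⁻¹' {i})) + Pi.single j 1) ∂Pr := by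
  have hN : Measurable fun (ω : PointConfig X) i => ω.toMeasure (c ⁻¹' {i}) :=
    measurable_pi_lambda _ fun i => PointConfig.measurable_toMeasure_apply (hc (.of_discrete))
  have hA : Measurable fun v : J → ℝ≥0∞ => Φ (v + Pi.single j 1) :=
    hΦ.comp (measurable_id.add_const _)
  rw [← lintegral_map (f := fun v : J → ℝ≥0∞ => v j * Φ v) (by fun_prop) hN,
    ← lintegral_map hA hN, hPr.map_fiber_counts hc,
    lintegral_eq_lmarginal_univ 0, lintegral_eq_lmarginal_univ 0,
    lmarginal_erase' _ (by fun_prop) (Finset.mem_univ j),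
    lmarginal_erase' _ (by fun_prop) (Finset.mem_univ j)]
  simp only [Function.update_self]
  have h : ∀ v : J → ℝ≥0∞,
      ∫⁻ t, t * Φ (Function.update v j t) ∂extPoisson (σ (c ⁻¹' {j})) = σ (c ⁻¹' {j}) *
        ∫⁻ t, Φ (Function.update v j t + Pi.single j 1) ∂extPoisson (σ (c ⁻¹' {j})) := by
    intro v
    rw [lintegral_mul_extPoisson hj (g := fun t => Φ (Function.update v j t))
      (hΦ.comp (measurable_update v))]
    congr 2
    ext1 t
    congr 1
    ext i
    by_cases hi : i = j
    · subst hi; simp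
    · simp [hi]
  simp_rw [h]
  rw [lmarginal, lmarginal, lintegral_const_mul' _ _ hj]

end IsPoissonMeasure

/-! ### Mecke's formula -/

namespace IsPoissonMeasure

variable {X : Type*} [MetricSpace X] [LocallyCompactSpace X] [SecondCountableTopology X]
  [MeasurableSpace X] [BorelSpace X] {σ : Measure X} [SigmaFinite σ] [NullSingletonClass σ]
  {Pr : Measure (PointConfig X)}

/-- Mecke's formula for functionals of the numbers of points in finitely many sets. The sets `B i`
generate a finite partition of `X`, whose classes are indexed by the possible values `J` of the
tuple of truth values `x ∈ B i`; the numbers of points in the classes are independent. -/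
theorem mecke_of_counts (hPr : IsPoissonMeasure σ Pr) {ι : Type*} [Fintype ι] {B : ι → Set X}
    (hB : ∀ i, MeasurableSet (B i)) (i₀ : ι) (hi₀ : σ (B i₀) ≠ ∞) {Ψ : (ι → ℝ≥0∞) → ℝ≥0∞}
    (hΨ : Measurable Ψ) :
    ∫⁻ ω, ω.toMeasure (B i₀) * Ψ (fun i => ω.toMeasure (B i)) ∂Pr =
      ∫⁻ ω, ∫⁻ x in B i₀, Ψ (fun i => (ω.addPoint x).toMeasure (B i)) ∂σ ∂Pr := by
  classical
  have := hPr.isProbabilityMeasure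
  let J := ι → Prop
  let c : X → J := fun x i => x ∈ B i
  have hc : Measurable c := measurable_pi_lambda _ fun i => measurable_mem.2 (hB i)
  have hD : ∀ j, MeasurableSet (c ⁻¹' {j}) := fun j => hc .of_discrete
  have hdisj : ∀ s : Set J, s.PairwiseDisjoint fun j => c ⁻¹' {j} := fun s i _ j _ hij =>
    Disjoint.preimage _ (by simpa using hij)
  have hunion : ∀ i, B i = ⋃ j ∈ Finset.univ.filter (fun j : J => j i), c ⁻¹' {j} := by
    intro i
    ext x
    simp [c]
  let R : (J → ℝ≥0∞) → ι → ℝ≥0∞ := fun v i => ∑ j with j i, v j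
  have hR : Measurable R := by fun_prop
  have hBR : ∀ (μ : Measure X), (fun i => μ (B i)) = R fun j => μ (c ⁻¹' {j}) := by
    intro μ
    ext i
    conv_lhs => rw [hunion i]
    exact measure_biUnion_finset (hdisj _) fun j _ => hD j
  have hadd : ∀ x, ∀ᵐ ω ∂Pr, (fun j => (ω.addPoint x).toMeasure (c ⁻¹' {j}))
      = (fun j => ω.toMeasure (c ⁻¹' {j})) + Pi.single (c x) 1 := by
    intro x
    filter_upwards [hPr.ae_toMeasure_singleton x] with ω hω
    ext j
    rw [PointConfig.toMeasure_addPoint _ _ (hD j), hω]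
    by_cases h : c x = j
    · subst h; simp
    · simp [h]
  have hfin : ∀ j ∈ Finset.univ.filter (fun j : J => j i₀), σ (c ⁻¹' {j}) ≠ ∞ := by
    intro j hj
    refine measure_ne_top_of_subset ?_ hi₀
    conv_rhs => rw [hunion i₀]
    exact Set.subset_biUnion_of_mem (u := fun j => c ⁻¹' {j}) hj
  have hmeas : Measurable (Function.uncurry fun (ω : PointConfig X) x =>
      Ψ (fun i => (ω.addPoint x).toMeasure (B i))) := by
    refine hΨ.comp (measurable_pi_lambda _ fun i => ?_)
    exact (PointConfig.measurable_toMeasure_apply (hB i)).comp PointConfig.measurable_addPoint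
  rw [lintegral_lintegral_swap hmeas.aemeasurable]
  conv_rhs => rw [hunion i₀]
  rw [lintegral_biUnion_finset (hdisj _) fun j _ => hD j]
  have hN : ∀ j, Measurable fun ω : PointConfig X => ω.toMeasure (c ⁻¹' {j}) := fun j =>
    PointConfig.measurable_toMeasure_apply (hD j)
  calc ∫⁻ ω, ω.toMeasure (B i₀) * Ψ (fun i => ω.toMeasure (B i)) ∂Pr
      = ∫⁻ ω, ∑ j with j i₀,
          ω.toMeasure (c ⁻¹' {j}) * Ψ (R fun j => ω.toMeasure (c ⁻¹' {j})) ∂Pr := by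
        refine lintegral_congr fun ω => ?_
        rw [← Finset.sum_mul, hBR]
        congr 1
        exact congrFun (hBR ω.toMeasure) i₀
    _ = ∑ j with j i₀, σ (c ⁻¹' {j}) *
          ∫⁻ ω, Ψ (R ((fun i => ω.toMeasure (c ⁻¹' {i})) + Pi.single j 1)) ∂Pr := by
        have hΨR : Measurable fun ω : PointConfig X =>
            Ψ (R fun j => ω.toMeasure (c ⁻¹' {j})) :=
          hΨ.comp (hR.comp (measurable_pi_lambda _ hN))
        rw [lintegral_finsetSum]
        swap
        · exact fun j _ => Measurable.mul (hN j) hΨR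
        exact Finset.sum_congr rfl fun j hj =>
          hPr.lintegral_mul_fiber_counts hc j (hfin j hj) (Φ := fun v => Ψ (R v)) (hΨ.comp hR)
    _ = _ := by
        refine Finset.sum_congr rfl fun j hj => ?_
        rw [mul_comm, ← setLIntegral_const]
        refine setLIntegral_congr_fun (hD j) fun x hx => ?_
        refine lintegral_congr_ae ?_
        filter_upwards [hadd x] with ω hω
        rw [hBR, hω, show c x = j from hx]

/-- Mecke's formula. -/
theorem mecke (hPr : IsPoissonMeasure σ Pr) {G : PointConfig X × X → ℝ≥0∞} (hG : Measurable G) :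
    ∫⁻ ω, ∫⁻ x, G (ω, x) ∂ω.toMeasure ∂Pr = ∫⁻ ω, ∫⁻ x, G (ω.addPoint x, x) ∂σ ∂Pr := by
  classical
  have := hPr.isProbabilityMeasure
  have hadd : Measurable fun p : PointConfig X × X => (p.1.addPoint p.2, p.2) :=
    PointConfig.measurable_addPoint.prodMk measurable_snd
  suffices h : Pr.compProd PointConfig.kernel
      = (Pr.prod σ).map fun p => (p.1.addPoint p.2, p.2) by
    have h1 : ∫⁻ ω, ∫⁻ x, G (ω, x) ∂ω.toMeasure ∂Pr =
        ∫⁻ p, G p ∂Pr.compProd PointConfig.kernel := by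
      rw [Measure.lintegral_compProd hG]
      rfl
    rw [h1, h, lintegral_map hG hadd,
      lintegral_prod (fun p : PointConfig X × X => G (p.1.addPoint p.2, p.2))
        (hG.comp hadd).aemeasurable]
  -- The events which prescribe the numbers of points in finitely many sets form a π-system.
  let m : Set X → MeasurableSpace (PointConfig X) := fun A =>
    MeasurableSpace.comap (fun ω => ω.toMeasure A) inferInstance
  let C : Set (Set (PointConfig X)) :=
    piiUnionInter (fun A => {s | MeasurableSet[m A] s}) {A | MeasurableSet A}
  have hCgen : MeasurableSpace.generateFrom C = PointConfig.instMeasurableSpace :=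
    generateFrom_piiUnionInter_measurableSet m {A | MeasurableSet A}
  have hCpi : IsPiSystem C := isPiSystem_piiUnionInter _ (fun A => (m A).isPiSystem_measurableSet) _
  have hCuniv : Set.univ ∈ C := ⟨∅, by simp, fun _ => Set.univ, by simp, by simp⟩
  have hCspan : IsCountablySpanning C := ⟨fun _ => Set.univ, fun _ => hCuniv, Set.iUnion_const _⟩
  -- On rectangles with a side of finite intensity measure the two measures agree.
  have key : ∀ E ∈ C, ∀ A, MeasurableSet A → σ A ≠ ∞ →
      Pr.compProd PointConfig.kernel (E ×ˢ A)
        = (Pr.prod σ).map (fun p => (p.1.addPoint p.2, p.2)) (E ×ˢ A) := by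
    rintro E hE A hA hσA
    have hEm : MeasurableSet E := by
      rw [← hCgen]; exact MeasurableSpace.measurableSet_generateFrom hE
    obtain ⟨t, ht, F, hF, rfl⟩ := hE
    choose! T hT hTF using hF
    let B : Option t → Set X := fun o => o.elim A Subtype.val
    have hB : ∀ i, MeasurableSet (B i) := by
      rintro (_ | ⟨b, hb⟩)
      · exact hA
      · exact ht hb
    let U : Set (Option t → ℝ≥0∞) := ⋂ b : t, (fun v => v (some b)) ⁻¹' T b
    have hU : MeasurableSet U := MeasurableSet.iInter fun b => measurable_pi_apply _ (hT b b.2)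
    have hEU : ∀ ω, ω ∈ ⋂ x ∈ t, F x ↔ (fun i => ω.toMeasure (B i)) ∈ U := by
      intro ω
      simp only [Set.mem_iInter, U, Subtype.forall, Set.mem_preimage]
      refine forall₂_congr fun b hb => ?_
      rw [← hTF b hb]
      rfl
    have h := hPr.mecke_of_counts hB none hσA (measurable_one.indicator hU)
    rw [Measure.compProd_apply_prod hEm hA, Measure.map_apply hadd (hEm.prod hA),
      Measure.prod_apply (hadd (hEm.prod hA)), ← lintegral_indicator hEm]
    convert h using 2 with ω ω
    · ext ω
      simp only [Set.indicator]
      simp only [hEU]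
      split_ifs
      · simp; rfl
      · simp
    · ext1 ω
      rw [← lintegral_indicator (hB none),
        ← lintegral_indicator_one (measurable_prodMk_left (hadd (hEm.prod hA)))]
      refine lintegral_congr fun x => ?_
      by_cases hx : x ∈ A
      · have hx' : x ∈ B none := hx
        simp [Set.indicator, hx, hx', hEU]
      · have hx' : x ∉ B none := hx
        simp [Set.indicator, hx, hx']
  refine Measure.ext_of_generateFrom_of_cover
    (S := Set.image2 (· ×ˢ ·) C {A | MeasurableSet A})
    (T := Set.range fun n => Set.univ ×ˢ spanningSets σ n)
    (generateFrom_eq_prod hCgen MeasurableSpace.generateFrom_measurableSet hCspan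
      isCountablySpanning_measurableSet).symm (Set.countable_range _)
    (hCpi.prod MeasurableSpace.isPiSystem_measurableSet) ?_ ?_ ?_ ?_
  · rw [Set.sUnion_range, ← Set.prod_iUnion, iUnion_spanningSets, Set.univ_prod_univ]
  · rintro _ ⟨n, rfl⟩
    rw [Measure.compProd_apply_prod .univ (measurableSet_spanningSets σ n), Measure.restrict_univ]
    exact ((hPr.lintegral_toMeasure (measurableSet_spanningSets σ n)
      (measure_spanningSets_lt_top σ n).ne).trans_lt (measure_spanningSets_lt_top σ n)).ne
  · rintro _ ⟨n, rfl⟩ _ ⟨E, hE, A, hA, rfl⟩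
    simp only [Set.prod_inter_prod, Set.inter_univ]
    exact key E hE _ (hA.inter (measurableSet_spanningSets σ n))
      (measure_ne_top_of_subset Set.inter_subset_right (measure_spanningSets_lt_top σ n).ne)
  · rintro _ ⟨n, rfl⟩
    exact key _ hCuniv _ (measurableSet_spanningSets σ n) (measure_spanningSets_lt_top σ n).ne

end IsPoissonMeasure

/-! ### Mecke's formula for mixed product measures -/

/-- Integration over `X^(k+1)` with the first coordinate as the outer variable. -/
theorem lintegral_pi_cons {X : Type*} [MeasurableSpace X] {k : ℕ} (μ : Fin (k + 1) → Measure X)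
    [∀ i, SigmaFinite (μ i)] {G : (Fin (k + 1) → X) → ℝ≥0∞} (hG : Measurable G) :
    ∫⁻ y, G y ∂Measure.pi μ =
      ∫⁻ x, ∫⁻ y, G (Fin.cons x y) ∂Measure.pi (fun i : Fin k => μ i.succ) ∂μ 0 := by
  have h := (measurePreserving_piFinSuccAbove μ 0).symm
  rw [← h.lintegral_comp hG, lintegral_prod
    (fun z => G ((MeasurableEquiv.piFinSuccAbove (fun _ => X) 0).symm z))
    (hG.comp h.measurable).aemeasurable]
  simp only [Fin.succAbove_zero]
  refine lintegral_congr fun x => lintegral_congr fun y => congrArg G ?_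
  exact Fin.insertNth_zero' x y

theorem measurable_finCons {X : Type*} [MeasurableSpace X] {k : ℕ} :
    Measurable fun p : X × (Fin k → X) => (Fin.cons p.1 p.2 : Fin (k + 1) → X) := by
  refine measurable_pi_lambda _ fun i => ?_
  refine Fin.cases ?_ (fun j => ?_) i
  · exact measurable_fst
  · exact (measurable_pi_apply j).comp measurable_snd

theorem measurableSet_injective {X J : Type*} [Finite J] [MeasurableSpace X] [MeasurableEq X] :
    MeasurableSet {y : J → X | Function.Injective y} := by
  have : {y : J → X | Function.Injective y} = ⋂ (i) (j) (_ : i ≠ j), {y | y i = y j}ᶜ := by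
    ext y
    simp only [Set.mem_ofPred_eq, Set.mem_iInter, Set.mem_compl_iff, Function.Injective]
    exact forall₂_congr fun i j => not_imp_not.symm
  rw [this]
  exact .iInter fun i => .iInter fun j => .iInter fun _ =>
    (measurableSet_eq_fun (measurable_pi_apply i) (measurable_pi_apply j)).compl

namespace PointConfig

/-- The configuration `ω ∪ {x}` if `e = 1`, and `ω` if `e = 0`. -/
noncomputable def addPointIf {X : Type*} [TopologicalSpace X] (ω : PointConfig X) (e : Fin 2)
    (x : X) : PointConfig X :=
  if e = 1 then ω.addPoint x else ω

theorem adjoin_cons {X : Type*} [TopologicalSpace X] (ω : PointConfig X) {k : ℕ}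
    (e : Fin (k + 1) → Fin 2) (x : X) (y : Fin k → X) :
    ω.adjoin e (Fin.cons x y : Fin (k + 1) → X)
      = (ω.adjoin (fun i => e i.succ) y).addPointIf (e 0) x := by
  ext z
  by_cases h : e 0 = 1
  · simp only [addPointIf, h, if_true, adjoin, unionFinite, addPoint, Set.mem_union,
      Set.mem_image, Set.mem_ofPred_eq, Set.mem_singleton_iff, Fin.exists_fin_succ, Fin.cons_zero,
      Fin.cons_succ, true_and, eq_comm (a := z)]
    rw [or_assoc, or_comm (a := x = z)]
  · simp only [addPointIf, h, if_false, adjoin, unionFinite, Set.mem_union,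
      Set.mem_image, Set.mem_ofPred_eq, Fin.exists_fin_succ, Fin.cons_zero,
      Fin.cons_succ]
    tauto

variable {X : Type u} [MetricSpace X] [LocallyCompactSpace X] [SecondCountableTopology X]
  [MeasurableSpace X] [BorelSpace X]

theorem measurable_addPointIf (e : Fin 2) :
    Measurable fun p : PointConfig X × X => p.1.addPointIf e p.2 := by
  unfold addPointIf
  split_ifs
  · exact measurable_addPoint
  · exact measurable_fst

theorem measurable_adjoin_fin {k : ℕ} (e : Fin k → Fin 2) :
    Measurable fun p : PointConfig X × (Fin k → X) => p.1.adjoin e p.2 := by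
  induction k with
  | zero =>
    convert measurable_fst with p
    ext z
    simp [adjoin, unionFinite]
  | succ k ih =>
    have h : (fun p : PointConfig X × (Fin (k + 1) → X) => p.1.adjoin e p.2) = fun p =>
        (p.1.adjoin (fun i => e i.succ) (Fin.tail p.2)).addPointIf (e 0) (p.2 0) := by
      ext1 p
      rw [← adjoin_cons, Fin.cons_self_tail]
    rw [h]
    have ht : Measurable fun p : PointConfig X × (Fin (k + 1) → X) => Fin.tail p.2 :=
      measurable_pi_lambda _ fun i => (measurable_pi_apply i.succ).comp measurable_snd
    exact (measurable_addPointIf (e 0)).comp (((ih _).comp (measurable_fst.prodMk ht)).prodMk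
      ((measurable_pi_apply 0).comp measurable_snd))

end PointConfig

section Mixed

variable {X : Type u} [MetricSpace X] [LocallyCompactSpace X] [SecondCountableTopology X]
  [MeasurableSpace X] [BorelSpace X] {σ : Measure X} [SigmaFinite σ]

instance instSigmaFiniteMixedMeasure (ω : PointConfig X) (e : Fin 2) :
    SigmaFinite (mixedMeasure σ ω e) := by
  unfold mixedMeasure
  split_ifs <;> infer_instance

theorem measurable_lintegral_mixedMeasure {A : Type*} [MeasurableSpace A] {φ : A → PointConfig X}
    (hφ : Measurable φ) (e : Fin 2) {G : A × X → ℝ≥0∞} (hG : Measurable G) :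
    Measurable fun a => ∫⁻ x, G (a, x) ∂mixedMeasure σ (φ a) e := by
  unfold mixedMeasure
  split_ifs
  · exact Measurable.lintegral_kernel_prod_right' (κ := PointConfig.kernel.comap φ hφ) hG
  · exact hG.lintegral_prod_right'

/-- The parameter space `A` is arbitrary so that an induction on `k` can move a coordinate
into it. -/
theorem measurable_lintegral_pi_mixedMeasure {k : ℕ} (e : Fin k → Fin 2) {A : Type u}
    [MeasurableSpace A] {φ : A → PointConfig X} (hφ : Measurable φ)
    {G : A × (Fin k → X) → ℝ≥0∞} (hG : Measurable G) :
    Measurable fun a => ∫⁻ y, G (a, y) ∂Measure.pi fun i => mixedMeasure σ (φ a) (e i) := by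
  induction k generalizing A with
  | zero =>
    have : ∀ a, ∫⁻ y, G (a, y) ∂Measure.pi (fun i => mixedMeasure σ (φ a) (e i))
        = G (a, Fin.elim0) := by
      intro a
      rw [Measure.pi_of_empty _ Fin.elim0, lintegral_dirac' _ (by fun_prop)]
    simp_rw [this]
    fun_prop
  | succ k ih =>
    have : ∀ a, ∫⁻ y, G (a, y) ∂Measure.pi (fun i => mixedMeasure σ (φ a) (e i))
        = ∫⁻ x, ∫⁻ y, G (a, Fin.cons x y) ∂Measure.pi (fun i => mixedMeasure σ (φ a) (e i.succ))
          ∂mixedMeasure σ (φ a) (e 0) := fun a =>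
      lintegral_pi_cons (fun i => mixedMeasure σ (φ a) (e i)) (G := fun y => G (a, y)) (by fun_prop)
    simp_rw [this]
    refine measurable_lintegral_mixedMeasure (σ := σ) (G := fun p : A × X =>
      ∫⁻ y, G (p.1, Fin.cons p.2 y) ∂Measure.pi fun i => mixedMeasure σ (φ p.1) (e i.succ)) hφ _ ?_
    refine ih (fun i => e i.succ) (A := A × X) (φ := fun p => φ p.1) (hφ.comp measurable_fst)
      (G := fun q => G (q.1.1, Fin.cons q.1.2 q.2)) (hG.comp ?_)
    exact (measurable_fst.comp measurable_fst).prodMk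
      (measurable_finCons.comp ((measurable_snd.comp measurable_fst).prodMk measurable_snd))

/-- On tuples that avoid `x`, adding `x` to the configuration does not change the mixed product
measure. -/
theorem restrict_pi_mixedMeasure_addPointIf {J : Type*} [Fintype J] (ω : PointConfig X)
    (e : J → Fin 2) (e₀ : Fin 2) (x : X) :
    (Measure.pi fun j => mixedMeasure σ (ω.addPointIf e₀ x) (e j)).restrict
        (Set.univ.pi fun _ => {x}ᶜ) =
      (Measure.pi fun j => mixedMeasure σ ω (e j)).restrict (Set.univ.pi fun _ => {x}ᶜ) := by
  rw [Measure.restrict_pi_pi, Measure.restrict_pi_pi]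
  congr 1
  ext1 j
  unfold mixedMeasure PointConfig.addPointIf
  split_ifs
  · exact ω.restrict_toMeasure_addPoint x
  · rfl
  · rfl

variable [NullSingletonClass σ] {Pr : Measure (PointConfig X)}

namespace IsPoissonMeasure

/-- For `e = 1` this is Mecke's formula, and for `e = 0` both sides are the same. -/
theorem mecke_mixed (hPr : IsPoissonMeasure σ Pr) (e : Fin 2) {G : PointConfig X × X → ℝ≥0∞}
    (hG : Measurable G) :
    ∫⁻ ω, ∫⁻ x, G (ω, x) ∂mixedMeasure σ ω e ∂Pr
      = ∫⁻ ω, ∫⁻ x, G (ω.addPointIf e x, x) ∂σ ∂Pr := by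
  unfold mixedMeasure PointConfig.addPointIf
  split_ifs
  · exact hPr.mecke hG
  · rfl

/-- The mixed Mecke formula: on tuples with pairwise different coordinates, the coordinates
integrated against the configuration may be integrated against `σ` and added to the
configuration. -/
theorem mecke_mixed_fin (hPr : IsPoissonMeasure σ Pr) {k : ℕ} (e : Fin k → Fin 2)
    {G : PointConfig X × (Fin k → X) → ℝ≥0∞} (hG : Measurable G) :
    ∫⁻ ω, ∫⁻ y in {y | Function.Injective y}, G (ω, y)
        ∂Measure.pi (fun i => mixedMeasure σ ω (e i)) ∂Pr =
      ∫⁻ ω, ∫⁻ y in {y | Function.Injective y}, G (ω.adjoin e y, y)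
        ∂Measure.pi (fun _ => σ) ∂Pr := by
  have := hPr.isProbabilityMeasure
  induction k with
  | zero =>
    refine lintegral_congr fun ω => ?_
    rw [Measure.pi_of_empty _ Fin.elim0, Measure.pi_of_empty _ Fin.elim0]
    refine lintegral_congr fun y => ?_
    congr 2
    ext z
    simp [PointConfig.adjoin, PointConfig.unionFinite]
  | succ k ih =>
    obtain ⟨D, hD_def⟩ : ∃ D : Set (X × (Fin k → X)),
      D = {p | p.2 ∈ Set.univ.pi fun _ => {p.1}ᶜ} := ⟨_, rfl⟩
    have hD : MeasurableSet D := by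
      have : D = ⋂ i, {p | p.2 i = p.1}ᶜ := by
        ext p
        simp [hD_def]
      rw [this]
      exact .iInter fun i => (measurableSet_eq_fun (by fun_prop) (by fun_prop)).compl
    -- For pairwise different `x, y₁, …, yₖ` the integral over `x` comes outermost.
    have hsplit : ∀ (μ : Fin (k + 1) → Measure X) [∀ i, SigmaFinite (μ i)]
        {H : (Fin (k + 1) → X) → ℝ≥0∞} (_ : Measurable H),
        ∫⁻ y in {y | Function.Injective y}, H y ∂Measure.pi μ =
          ∫⁻ x, ∫⁻ y in {y | Function.Injective y},
            D.indicator (fun p => H (Fin.cons p.1 p.2)) (x, y)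
            ∂Measure.pi (fun i : Fin k => μ i.succ) ∂μ 0 := by
      intro μ _ H hH
      rw [← lintegral_indicator measurableSet_injective,
        lintegral_pi_cons _ (hH.indicator measurableSet_injective)]
      refine lintegral_congr fun x => ?_
      rw [← lintegral_indicator measurableSet_injective]
      refine lintegral_congr fun y => ?_
      have h1 : Function.Injective (Fin.cons x y : Fin (k + 1) → X) ↔
          (x, y) ∈ D ∧ Function.Injective y := by
        rw [Fin.cons_injective_iff]
        simp [hD_def]
      simp only [Set.indicator, Set.mem_ofPred_eq]
      by_cases h : (x, y) ∈ D ∧ Function.Injective y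
      · rw [if_pos (h1.2 h), if_pos h.2, if_pos h.1]
      · rw [if_neg (fun h' => h (h1.1 h'))]
        split_ifs with h2 h3
        exacts [(h ⟨h3, h2⟩).elim, rfl, rfl]
    have hcons : Measurable fun q : (PointConfig X × X) × (Fin k → X) =>
        (q.1.1, (Fin.cons q.1.2 q.2 : Fin (k + 1) → X)) :=
      (measurable_fst.comp measurable_fst).prodMk
        (measurable_finCons.comp ((measurable_snd.comp measurable_fst).prodMk measurable_snd))
    have hGcons : Measurable fun q : (PointConfig X × X) × (Fin k → X) =>
        D.indicator (fun p => G (q.1.1, Fin.cons p.1 p.2)) (q.1.2, q.2) :=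
      (hG.comp hcons).indicator 
        (s := (fun q : (PointConfig X × X) × (Fin k → X) => (q.1.2, q.2)) ⁻¹' D)
        (((measurable_snd.comp measurable_fst).prodMk measurable_snd) hD)
    have hind : Measurable fun q : (PointConfig X × X) × (Fin k → X) =>
        {y : Fin k → X | Function.Injective y}.indicator
          (fun y => D.indicator (fun p => G (q.1.1, Fin.cons p.1 p.2)) (q.1.2, y)) q.2 :=
      hGcons.indicator 
        (s := (fun q : (PointConfig X × X) × (Fin k → X) => q.2) ⁻¹'
          {y : Fin k → X | Function.Injective y})
        (measurable_snd measurableSet_injective)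
    have hadd : Measurable fun q : (PointConfig X × X) × (Fin k → X) =>
        ((q.1.1.addPointIf (e 0) q.1.2, q.1.2), q.2) :=
      (((PointConfig.measurable_addPointIf (e 0)).comp measurable_fst).prodMk
        (measurable_snd.comp measurable_fst)).prodMk measurable_snd
    have hadj : Measurable fun q : (PointConfig X × X) × (Fin k → X) =>
        ((q.1.1.adjoin (fun i => e i.succ) q.2, q.1.2), q.2) :=
      (((PointConfig.measurable_adjoin_fin _).comp
        ((measurable_fst.comp measurable_fst).prodMk measurable_snd)).prodMk
        (measurable_snd.comp measurable_fst)).prodMk measurable_snd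
    calc ∫⁻ ω, ∫⁻ y in {y | Function.Injective y}, G (ω, y)
            ∂Measure.pi (fun i => mixedMeasure σ ω (e i)) ∂Pr
        = ∫⁻ ω, ∫⁻ x, ∫⁻ y in {y | Function.Injective y},
            D.indicator (fun p => G (ω, Fin.cons p.1 p.2)) (x, y)
            ∂Measure.pi (fun i => mixedMeasure σ ω (e i.succ)) ∂mixedMeasure σ ω (e 0) ∂Pr :=
          lintegral_congr fun ω => hsplit _ (hG.comp measurable_prodMk_left)
      _ = ∫⁻ ω, ∫⁻ x, ∫⁻ y in {y | Function.Injective y},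
            D.indicator (fun p => G (ω.addPointIf (e 0) x, Fin.cons p.1 p.2)) (x, y)
            ∂Measure.pi (fun i => mixedMeasure σ (ω.addPointIf (e 0) x) (e i.succ)) ∂σ ∂Pr := by
          refine hPr.mecke_mixed (e 0) (G := fun q => ∫⁻ y in {y | Function.Injective y},
            D.indicator (fun p => G (q.1, Fin.cons p.1 p.2)) (q.2, y)
            ∂Measure.pi (fun i => mixedMeasure σ q.1 (e i.succ))) ?_
          simp_rw [← lintegral_indicator measurableSet_injective]
          exact measurable_lintegral_pi_mixedMeasure (A := PointConfig X × X) _ measurable_fst hind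
      _ = ∫⁻ ω, ∫⁻ x, ∫⁻ y in {y | Function.Injective y},
            D.indicator (fun p => G (ω.addPointIf (e 0) x, Fin.cons p.1 p.2)) (x, y)
            ∂Measure.pi (fun i => mixedMeasure σ ω (e i.succ)) ∂σ ∂Pr := by
          refine lintegral_congr fun ω => lintegral_congr fun x => ?_
          have hx : MeasurableSet (Set.univ.pi fun _ : Fin k => ({x}ᶜ : Set X)) :=
            .univ_pi fun _ => (measurableSet_singleton x).compl
          have h : ∀ y, D.indicator (fun p => G (ω.addPointIf (e 0) x, Fin.cons p.1 p.2)) (x, y)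
              = (Set.univ.pi fun _ : Fin k => ({x}ᶜ : Set X)).indicator
                (fun y => G (ω.addPointIf (e 0) x, Fin.cons x y)) y := fun y => by rw [hD_def]; rfl
          have h' : ∀ μ : Measure (Fin k → X), ∫⁻ y in {y | Function.Injective y},
              D.indicator (fun p => G (ω.addPointIf (e 0) x, Fin.cons p.1 p.2)) (x, y) ∂μ =
              ∫⁻ y in {y | Function.Injective y}, G (ω.addPointIf (e 0) x, Fin.cons x y)
                ∂μ.restrict (Set.univ.pi fun _ : Fin k => ({x}ᶜ : Set X)) := by
            intro μ
            rw [lintegral_congr h, lintegral_indicator hx, Measure.restrict_restrict hx,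
              Set.inter_comm, ← Measure.restrict_restrict measurableSet_injective]
          rw [h', h', restrict_pi_mixedMeasure_addPointIf]
      _ = ∫⁻ x, ∫⁻ ω, ∫⁻ y in {y | Function.Injective y},
            D.indicator (fun p => G (ω.addPointIf (e 0) x, Fin.cons p.1 p.2)) (x, y)
            ∂Measure.pi (fun i => mixedMeasure σ ω (e i.succ)) ∂Pr ∂σ := by
          refine lintegral_lintegral_swap (Measurable.aemeasurable ?_)
          simp only [Function.uncurry_def]
          simp_rw [← lintegral_indicator measurableSet_injective]
          exact measurable_lintegral_pi_mixedMeasure (A := PointConfig X × X) _ measurable_fst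
            (hind.comp hadd)
      _ = ∫⁻ x, ∫⁻ ω, ∫⁻ y in {y | Function.Injective y},
            D.indicator (fun p => G (ω.adjoin e (Fin.cons p.1 p.2 : Fin (k + 1) → X),
              Fin.cons p.1 p.2)) (x, y)
            ∂Measure.pi (fun _ : Fin k => σ) ∂Pr ∂σ := by
          refine lintegral_congr fun x => ?_
          rw [ih (fun i => e i.succ) (G := fun q =>
            D.indicator (fun p => G (q.1.addPointIf (e 0) x, Fin.cons p.1 p.2)) (x, q.2))]
          · refine lintegral_congr fun ω => lintegral_congr fun y => ?_
            simp only [Set.indicator, PointConfig.adjoin_cons]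
          · exact (hGcons.comp hadd).comp (f := fun q : PointConfig X × (Fin k → X) =>
              ((q.1, x), q.2)) (by fun_prop)
      _ = ∫⁻ ω, ∫⁻ x, ∫⁻ y in {y | Function.Injective y},
            D.indicator (fun p => G (ω.adjoin e (Fin.cons p.1 p.2 : Fin (k + 1) → X),
              Fin.cons p.1 p.2)) (x, y)
            ∂Measure.pi (fun _ : Fin k => σ) ∂σ ∂Pr := by
          refine (lintegral_lintegral_swap (Measurable.aemeasurable ?_)).symm
          simp only [Function.uncurry_def]
          simp_rw [← lintegral_indicator measurableSet_injective]
          refine Measurable.lintegral_prod_right' (f := fun q : (PointConfig X × X) × (Fin k → X) =>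
            {y : Fin k → X | Function.Injective y}.indicator (fun y =>
              D.indicator (fun p => G (q.1.1.adjoin e (Fin.cons p.1 p.2 : Fin (k + 1) → X),
              Fin.cons p.1 p.2)) (q.1.2, y)) q.2) ?_
          have := (hind.comp hadd).comp hadj
          convert this using 1
          ext q
          simp only [Set.indicator, PointConfig.adjoin_cons, Function.comp]
      _ = _ := by
          refine lintegral_congr fun ω => ?_
          refine (hsplit (fun _ => σ) (H := fun y => G (ω.adjoin e y, y)) ?_).symm
          exact hG.comp (((PointConfig.measurable_adjoin_fin e).comp
            measurable_prodMk_left).prodMk measurable_id)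

end IsPoissonMeasure

end Mixed

/-! ### Product measures and diagonals -/

section PiMeasure

theorem lintegral_pi_prod {I : Type*} [Fintype I] {Y : I → Type*} [∀ i, MeasurableSpace (Y i)]
    (μ : ∀ i, Measure (Y i)) [∀ i, SigmaFinite (μ i)] {g : ∀ i, Y i → ℝ≥0∞}
    (hg : ∀ i, Measurable (g i)) :
    ∫⁻ w, ∏ i, g i (w i) ∂Measure.pi μ = ∏ i, ∫⁻ x, g i x ∂μ i := by
  classical
  have key : ∀ (s : Finset I) (w : ∀ i, Y i),
      (∫⋯∫⁻_s, (fun w => ∏ i ∈ s, g i (w i)) ∂μ) w = ∏ i ∈ s, ∫⁻ x, g i x ∂μ i := by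
    intro s
    induction s using Finset.induction with
    | empty => simp
    | insert i s hi ih =>
      intro w
      have hm : Measurable fun w : ∀ i, Y i => ∏ i ∈ s, g i (w i) := by fun_prop
      rw [lmarginal_insert' _ (by fun_prop) hi, Finset.prod_insert hi, ← ih w, lmarginal, lmarginal,
        ← lintegral_const_mul (f := fun v => ∏ j ∈ s, g j (Function.updateFinset w s v j)) _
          (hm.comp measurable_updateFinset)]
      refine lintegral_congr fun v => ?_
      rw [← lintegral_mul_const _ (hg i)]
      refine lintegral_congr fun x => ?_
      rw [Finset.prod_insert hi, Function.update_self]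
      congr 1
      refine Finset.prod_congr rfl fun j hj => ?_
      rw [Function.update_of_ne (ne_of_mem_of_not_mem hj hi)]
  by_cases h : Nonempty (∀ i, Y i)
  · obtain ⟨w⟩ := h
    rw [lintegral_eq_lmarginal_univ w]
    exact key Finset.univ w
  · have : IsEmpty (∀ i, Y i) := not_nonempty_iff.1 h
    obtain ⟨i, hi⟩ := isEmpty_pi.1 this
    rw [lintegral_of_isEmpty, Finset.prod_eq_zero (Finset.mem_univ i) (lintegral_of_isEmpty _ _)]

/-- A product measure may be formed in two steps, first within the classes `κ i` of a partition of
the index set. -/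
theorem map_pi_pi {S I : Type*} [Fintype S] [Fintype I] {κ : I → Type*} [∀ i, Fintype (κ i)]
    {X : Type*} [MeasurableSpace X] (φ : (Σ i, κ i) ≃ S) (μ : S → Measure X)
    [∀ s, SigmaFinite (μ s)] :
    (Measure.pi fun i => Measure.pi fun k => μ (φ ⟨i, k⟩)).map
      (fun (w : ∀ i, κ i → X) s => w (φ.symm s).1 (φ.symm s).2) = Measure.pi μ := by
  refine (Measure.pi_eq fun A hA => ?_).symm
  have hm : Measurable fun (w : ∀ i, κ i → X) s => w (φ.symm s).1 (φ.symm s).2 := by fun_prop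
  have h : (fun (w : ∀ i, κ i → X) s => w (φ.symm s).1 (φ.symm s).2) ⁻¹' Set.univ.pi A
      = Set.univ.pi fun i => Set.univ.pi fun k => A (φ ⟨i, k⟩) := by
    ext w
    simp only [Set.mem_preimage, Set.mem_univ_pi]
    constructor
    · intro h i k
      have h' := h (φ ⟨i, k⟩)
      rwa [φ.symm_apply_apply] at h'
    · intro h s
      simpa using h (φ.symm s).1 (φ.symm s).2
  rw [Measure.map_apply hm (.univ_pi hA), h]
  simp_rw [Measure.pi_pi]
  rw [← φ.prod_comp, Fintype.prod_sigma]

theorem pi_setOf_eq_null {S : Type*} [Fintype S] {X : Type*} [MeasurableSpace X]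
    [MeasurableSingletonClass X] [MeasurableEq X] (μ : S → Measure X) [∀ s, SigmaFinite (μ s)]
    {s t : S} (hst : s ≠ t)
    [NullSingletonClass (μ s)] : Measure.pi μ {z | z s = z t} = 0 := by
  classical
  by_cases h : Nonempty X
  · obtain ⟨x₀⟩ := h
    have hm : MeasurableSet {z : S → X | z s = z t} :=
      measurableSet_eq_fun (measurable_pi_apply s) (measurable_pi_apply t)
    rw [← lintegral_indicator_one hm, lintegral_eq_lmarginal_univ fun _ => x₀,
      lmarginal_erase' _ (measurable_one.indicator hm) (Finset.mem_univ s)]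
    have : ∀ z : S → X, ∫⁻ x, {z : S → X | z s = z t}.indicator 1 (Function.update z s x) ∂μ s
        = 0 := by
      intro z
      have : ∀ x, {z : S → X | z s = z t}.indicator (1 : (S → X) → ℝ≥0∞) (Function.update z s x)
          = ({z t} : Set X).indicator 1 x := by
        intro x
        simp [Set.indicator, Function.update_of_ne hst.symm]
      simp_rw [this]
      rw [lintegral_indicator_one (measurableSet_singleton _), measure_singleton]
    simp_rw [this]
    simp [lmarginal]
  · have : IsEmpty (S → X) := ⟨fun z => h ⟨z s⟩⟩
    rw [Set.eq_empty_of_isEmpty {z : S → X | z s = z t}, measure_empty]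

/-- Let the index set `S` be partitioned into the fibres of `f : S → J`. If within each fibre the
part of the power of `ν j` that lives on the diagonal is the image of `ν j`, then the part of the
product measure on the tuples that are constant on the fibres is the image of the product measure
over `J`. -/
theorem restrict_pi_eq_map_comp {S J : Type*} [Fintype S] [Fintype J] [DecidableEq J] {X : Type*}
    [MeasurableSpace X] [MeasurableEq X] {f : S → J} (ν : J → Measure X) [∀ j, SigmaFinite (ν j)]
    (h : ∀ j, (Measure.pi fun _ : {s // f s = j} => ν j).restrict {w | ∀ s t, w s = w t}
      = (ν j).map fun x _ => x) :
    (Measure.pi fun s => ν (f s)).restrict {z | ∀ s t, f s = f t → z s = z t} =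
      (Measure.pi ν).map fun y s => y (f s) := by
  have hC : MeasurableSet {z : S → X | ∀ s t, f s = f t → z s = z t} := by
    have : {z : S → X | ∀ s t, f s = f t → z s = z t}
        = ⋂ (s) (t) (_ : f s = f t), {z | z s = z t} := by ext; simp
    rw [this]
    exact .iInter fun s => .iInter fun t => .iInter fun _ =>
      measurableSet_eq_fun (measurable_pi_apply s) (measurable_pi_apply t)
  let φ := Equiv.sigmaFiberEquiv f
  have hT : Measurable fun (w : ∀ j, {s // f s = j} → X) s => w (φ.symm s).1 (φ.symm s).2 := by
    fun_prop
  rw [← map_pi_pi φ, Measure.restrict_map hT hC]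
  have hpre : (fun (w : ∀ j, {s // f s = j} → X) s => w (φ.symm s).1 (φ.symm s).2) ⁻¹'
      {z | ∀ s t, f s = f t → z s = z t} = Set.univ.pi fun j => {w | ∀ s t, w s = w t} := by
    ext w
    have hw : ∀ j (k : {s // f s = j}), w j k = w (f k) ⟨k, rfl⟩ := by
      rintro j ⟨k, rfl⟩
      rfl
    simp only [Set.mem_preimage, Set.mem_univ_pi, Set.mem_ofPred_eq]
    constructor
    · intro h j k k'
      rw [hw j k, hw j k']
      exact h k k' (k.2.trans k'.2.symm)
    · intro h s t hst
      exact (h (f s) ⟨s, rfl⟩ ⟨t, hst.symm⟩).trans (hw _ _)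
  have hν : ∀ j, (fun k : {s // f s = j} => ν (f (φ ⟨j, k⟩))) = fun _ => ν j := by
    intro j
    ext1 k
    exact congrArg ν k.2
  simp_rw [hν]
  have hsf : ∀ j, SigmaFinite ((ν j).map fun x (_ : {s // f s = j}) => x) := fun j => by
    rw [← h j]; infer_instance
  rw [hpre, Measure.restrict_pi_pi]
  simp_rw [h]
  rw [← Measure.pi_map_pi (fun j => by fun_prop), Measure.map_map hT (by fun_prop)]
  rfl

theorem restrict_pi_diagonal_of_subsingleton {T : Type*} [Fintype T] [Subsingleton T] [Nonempty T]
    {X : Type*} [MeasurableSpace X] (ν : Measure X) [SigmaFinite ν] :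
    (Measure.pi fun _ : T => ν).restrict {w | ∀ s t, w s = w t} = ν.map fun x _ => x := by
  have huniv : {w : T → X | ∀ s t, w s = w t} = Set.univ :=
    Set.eq_univ_of_forall fun w s t => by rw [Subsingleton.elim s t]
  rw [huniv, Measure.restrict_univ]
  refine Measure.pi_eq fun A hA => ?_
  obtain ⟨t₀⟩ := ‹Nonempty T›
  have := uniqueOfSubsingleton t₀
  rw [Measure.map_apply (by fun_prop) (.univ_pi hA), Fintype.prod_unique]
  congr 1
  ext x
  simp [Unique.forall_iff]

end PiMeasure

section Diagonal

variable {X : Type u} [MetricSpace X] [LocallyCompactSpace X] [SecondCountableTopology X]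
  [MeasurableSpace X] [BorelSpace X]

/-- The atoms of a configuration have mass one, so each point of the diagonal has the mass one in
every power of the configuration. -/
theorem PointConfig.restrict_pi_diagonal (ω : PointConfig X) {T : Type*} [Fintype T] [Nonempty T] :
    (Measure.pi fun _ : T => ω.toMeasure).restrict {w | ∀ s t, w s = w t}
      = ω.toMeasure.map fun x _ => x := by
  ext E hE
  have hconst : Measurable fun (x : X) (_ : T) => x := by fun_prop
  have hae : ∀ᵐ w ∂(Measure.pi fun _ : T => ω.toMeasure), ∀ t, w t ∈ ω.carrier := by
    rw [ae_all_iff]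
    intro t
    exact (Measure.tendsto_eval_ae_ae (i := t)).eventually (p := fun x => x ∈ ω.carrier)
      (mem_ae_iff.2 ω.toMeasure_compl_carrier)
  have hset : E ∩ {w | ∀ s t, w s = w t} ∩ {w | ∀ t, w t ∈ ω.carrier}
      = ⋃ x ∈ ω.carrier ∩ (fun x (_ : T) => x) ⁻¹' E, {fun _ => x} := by
    ext w
    simp only [Set.mem_inter_iff, Set.mem_ofPred_eq, Set.mem_iUnion, Set.mem_preimage,
      Set.mem_singleton_iff, exists_prop]
    constructor
    · rintro ⟨⟨hwE, hw⟩, hwc⟩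
      obtain ⟨t⟩ := ‹Nonempty T›
      have : w = fun _ => w t := funext fun s => hw s t
      exact ⟨w t, ⟨hwc t, this ▸ hwE⟩, this⟩
    · rintro ⟨x, ⟨hx, hxE⟩, rfl⟩
      exact ⟨⟨hxE, fun _ _ => rfl⟩, fun _ => hx⟩
  rw [Measure.restrict_apply hE, Measure.map_apply hconst hE, ω.toMeasure_apply (hconst hE),
    ← measure_inter_conull (t := {w : T → X | ∀ t, w t ∈ ω.carrier}) (mem_ae_iff.1 hae), hset,
    measure_biUnion (ω.countable_carrier.mono Set.inter_subset_left), ← ENNReal.tsum_set_one]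
  · refine tsum_congr fun x => ?_
    rw [Measure.pi_singleton]
    simp [ω.toMeasure_singleton, x.2.1]
  · intro x _ y _ hxy
    simp only [Function.onFun, Set.disjoint_singleton]
    exact fun h => hxy (congrFun h (Classical.arbitrary T))
  · exact fun x _ => measurableSet_singleton _

variable {σ : Measure X} [SigmaFinite σ]

/-- The tuples whose coordinates coincide exactly on the fibres of `f` are parametrized by their
different values, one for each `j : J`. -/
theorem setLIntegral_pi_mixedMeasure_fibers {S J : Type*} [Fintype S] [Fintype J]
    (ω : PointConfig X) {f : S → J} (hf : Function.Surjective f) (e : J → Fin 2)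
    (he : ∀ s t, s ≠ t → f s = f t → e (f s) = 1) {H : (S → X) → ℝ≥0∞} (hH : Measurable H) :
    ∫⁻ z in {z | ∀ s t, z s = z t ↔ f s = f t}, H z
        ∂Measure.pi (fun s => mixedMeasure σ ω (e (f s))) =
      ∫⁻ y in {y | Function.Injective y}, H (fun s => y (f s))
        ∂Measure.pi (fun j => mixedMeasure σ ω (e j)) := by
  classical
  have h := restrict_pi_eq_map_comp (f := f) (fun j => mixedMeasure σ ω (e j)) (by
    intro j
    obtain ⟨s, hs⟩ := hf j
    have : Nonempty {s // f s = j} := ⟨⟨s, hs⟩⟩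
    by_cases hj : e j = 1
    · simp only [mixedMeasure, hj, if_true]
      exact ω.restrict_pi_diagonal
    · have : Subsingleton {s // f s = j} := by
        refine ⟨fun s t => Subtype.ext ?_⟩
        by_contra hne
        exact hj (s.2 ▸ he s t hne (s.2.trans t.2.symm))
      exact restrict_pi_diagonal_of_subsingleton _)
  have hE : MeasurableSet {z : S → X | ∀ s t, z s = z t → f s = f t} := by
    have : {z : S → X | ∀ s t, z s = z t → f s = f t}
        = ⋂ (s) (t) (_ : f s ≠ f t), {z | z s = z t}ᶜ := by
      ext z
      simp only [Set.mem_ofPred_eq, Set.mem_iInter, Set.mem_compl_iff]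
      exact forall₂_congr fun i j => not_imp_not.symm
    rw [this]
    exact .iInter fun s => .iInter fun t => .iInter fun _ =>
      (measurableSet_eq_fun (measurable_pi_apply s) (measurable_pi_apply t)).compl
  have hset : {z : S → X | ∀ s t, z s = z t ↔ f s = f t}
      = {z | ∀ s t, z s = z t → f s = f t} ∩ {z | ∀ s t, f s = f t → z s = z t} := by
    ext z
    simp only [Set.mem_ofPred_eq, Set.mem_inter_iff, iff_def, forall_and]
  have hpre : (fun (y : J → X) s => y (f s)) ⁻¹' {z : S → X | ∀ s t, z s = z t → f s = f t}
      = {y | Function.Injective y} := by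
    ext y
    simp only [Set.mem_preimage, Set.mem_ofPred_eq, Function.Injective]
    rw [hf.forall₂]
  rw [hset, ← Measure.restrict_restrict hE, h, setLIntegral_map hE hH (by fun_prop), hpre]

end Diagonal

/-! ### The moment formula -/

section Reindex

variable {X : Type u}

theorem measurePreserving_comp_equiv [MeasurableSpace X] {J J' : Type*} [Fintype J] [Fintype J']
    (φ : J' ≃ J) (μ : J → Measure X) [∀ j, SigmaFinite (μ j)] :
    MeasurePreserving (fun (z : J' → X) j => z (φ.symm j)) (Measure.pi fun i => μ (φ i))
      (Measure.pi μ) := by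
  convert measurePreserving_piCongrLeft μ φ using 1
  ext z j
  obtain ⟨i, rfl⟩ := φ.surjective j
  simp [MeasurableEquiv.piCongrLeft]

theorem PointConfig.adjoin_comp_equiv [TopologicalSpace X] {J J' : Type} [Finite J] [Finite J']
    (φ : J' ≃ J) (ω : PointConfig X) (e : J → Fin 2) (z : J' → X) :
    ω.adjoin e (fun j => z (φ.symm j)) = ω.adjoin (fun i => e (φ i)) z := by
  ext x
  simp [adjoin, unionFinite, φ.symm.exists_congr_left]

variable [MetricSpace X] [LocallyCompactSpace X] [SecondCountableTopology X]
  [MeasurableSpace X] [BorelSpace X] {σ : Measure X} [SigmaFinite σ]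

theorem measurable_lintegral_pi_mixedMeasure' {J : Type*} [Fintype J] (e : J → Fin 2)
    {G : PointConfig X × (J → X) → ℝ≥0∞} (hG : Measurable G) :
    Measurable fun ω => ∫⁻ y, G (ω, y) ∂Measure.pi fun j => mixedMeasure σ ω (e j) := by
  let φ := (Fintype.equivFin J).symm
  have h : ∀ ω, ∫⁻ y, G (ω, y) ∂Measure.pi (fun j => mixedMeasure σ ω (e j))
      = ∫⁻ z, G (ω, fun j => z (φ.symm j)) ∂Measure.pi fun i => mixedMeasure σ ω (e (φ i)) :=
    fun ω => ((measurePreserving_comp_equiv φ fun j => mixedMeasure σ ω (e j)).lintegral_comp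
      (f := fun y => G (ω, y)) (by fun_prop)).symm
  simp_rw [h]
  exact measurable_lintegral_pi_mixedMeasure (G := fun p => G (p.1, fun j => p.2 (φ.symm j)))
    (fun i => e (φ i)) measurable_id (by fun_prop)

/-- `IsPoissonMeasure.mecke_mixed_fin` for an arbitrary finite index type, such as the set of blocks
of a partition. -/
theorem IsPoissonMeasure.mecke_mixed_fintype [NullSingletonClass σ] {Pr : Measure (PointConfig X)}
    (hPr : IsPoissonMeasure σ Pr) {J : Type} [Fintype J] (e : J → Fin 2)
    {G : PointConfig X × (J → X) → ℝ≥0∞} (hG : Measurable G) :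
    ∫⁻ ω, ∫⁻ y in {y | Function.Injective y}, G (ω, y)
        ∂Measure.pi (fun j => mixedMeasure σ ω (e j)) ∂Pr =
      ∫⁻ ω, ∫⁻ y in {y | Function.Injective y}, G (ω.adjoin e y, y)
        ∂Measure.pi (fun _ => σ) ∂Pr := by
  let φ := (Fintype.equivFin J).symm
  have hpre : (fun (z : Fin (Fintype.card J) → X) j => z (φ.symm j)) ⁻¹'
      {y | Function.Injective y} = {z | Function.Injective z} := by
    ext z
    exact φ.symm.injective_comp z
  have hadj : Measurable fun p : PointConfig X × (J → X) => p.1.adjoin e p.2 := by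
    have : (fun p : PointConfig X × (J → X) => p.1.adjoin e p.2)
        = fun p => p.1.adjoin (fun i => e (φ i)) (fun i => p.2 (φ i)) := by
      ext1 p
      rw [← PointConfig.adjoin_comp_equiv]
      simp
    rw [this]
    exact (PointConfig.measurable_adjoin_fin _).comp
      (f := fun p : PointConfig X × (J → X) => (p.1, fun i => p.2 (φ i))) (by fun_prop)
  have key : ∀ (μ : J → Measure X) [∀ j, SigmaFinite (μ j)] {H : (J → X) → ℝ≥0∞}
      (_ : Measurable H), ∫⁻ y in {y | Function.Injective y}, H y ∂Measure.pi μ =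
        ∫⁻ z in {z | Function.Injective z}, H (fun j => z (φ.symm j))
          ∂Measure.pi fun i => μ (φ i) := by
    intro μ _ H hH
    rw [← (measurePreserving_comp_equiv φ μ).setLIntegral_comp_preimage
      measurableSet_injective hH, hpre]
  have h := hPr.mecke_mixed_fin (fun i => e (φ i))
    (G := fun p => G (p.1, fun j => p.2 (φ.symm j))) (by fun_prop)
  calc _ = _ := lintegral_congr fun ω => key _ (hG.comp measurable_prodMk_left)
    _ = _ := h
    _ = _ := by
      refine lintegral_congr fun ω => ?_
      rw [key (fun _ => σ) (H := fun y => G (ω.adjoin e y, y))]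
      · simp_rw [PointConfig.adjoin_comp_equiv]
      · exact hG.comp ((hadj.comp measurable_prodMk_left).prodMk measurable_id)

end Reindex

section Partition

/-- The tuples whose coordinates at `s` and `t` coincide if and only if `s` and `t` lie in the same
block of `P`. -/
def levelTuples {S : Type*} [DecidableEq S] [Fintype S] (P : Finpartition (Finset.univ : Finset S))
    (X : Type*) : Set (S → X) :=
  {z | ∀ s t, z s = z t ↔ P.part s = P.part t}

theorem measurableSet_levelTuples {S : Type*} [DecidableEq S] [Fintype S]
    (P : Finpartition (Finset.univ : Finset S)) {X : Type*} [MeasurableSpace X] [MeasurableEq X] :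
    MeasurableSet (levelTuples P X) := by
  have : levelTuples P X = ⋂ (s) (t), {z | z s = z t ↔ P.part s = P.part t} := by
    ext
    simp [levelTuples]
  rw [this]
  refine .iInter fun s => .iInter fun t => ?_
  have hst : MeasurableSet {z : S → X | z s = z t} :=
    measurableSet_eq_fun (measurable_pi_apply s) (measurable_pi_apply t)
  by_cases h : P.part s = P.part t
  · simp only [h, iff_true]
    exact hst
  · simp only [h, iff_false]
    exact hst.compl

/-- Every tuple `z` determines the partition of its index set into the level sets of `z`; this cuts
an integral over all tuples into integrals over the tuples with a given partition. -/
theorem lintegral_eq_sum_finpartition {S : Type*} [Fintype S] [DecidableEq S] {X : Type*}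
    [MeasurableSpace X] [MeasurableEq X] (μ : Measure (S → X)) (H : (S → X) → ℝ≥0∞) :
    ∫⁻ z, H z ∂μ = ∑ P : Finpartition (Finset.univ : Finset S),
      ∫⁻ z in levelTuples P X, H z ∂μ := by
  classical
  have hdisj : Set.PairwiseDisjoint
      (SetLike.coe (Finset.univ : Finset (Finpartition (Finset.univ : Finset S))))
      fun P => levelTuples P X := by
    intro P _ Q _ hPQ
    refine Set.disjoint_left.2 fun z hP hQ => hPQ ?_
    have hpart : ∀ s, P.part s = Q.part s := by
      intro s
      ext t
      rw [P.mem_part_iff_part_eq_part (Finset.mem_univ _) (Finset.mem_univ _),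
        Q.mem_part_iff_part_eq_part (Finset.mem_univ _) (Finset.mem_univ _), ← hP t s, ← hQ t s]
    have hle : ∀ P Q : Finpartition (Finset.univ : Finset S), (∀ s, P.part s = Q.part s) →
        P.parts ⊆ Q.parts := by
      intro P Q h B hB
      obtain ⟨s, hs⟩ := P.nonempty_of_mem_parts hB
      rw [← P.part_eq_of_mem hB hs, h]
      exact Q.part_mem.2 (Finset.mem_univ s)
    exact Finpartition.ext ((hle P Q hpart).antisymm (hle Q P fun s => (hpart s).symm))
  have hunion : ⋃ P ∈ (Finset.univ : Finset (Finpartition (Finset.univ : Finset S))),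
      levelTuples P X = Set.univ := by
    refine Set.eq_univ_of_forall fun z => ?_
    let P := Finpartition.ofSetoid (Setoid.ker z)
    simp only [Finset.mem_univ, Set.iUnion_true, Set.mem_iUnion]
    refine ⟨P, fun s t => ?_⟩
    rw [← P.mem_part_iff_part_eq_part (Finset.mem_univ _) (Finset.mem_univ _),
      Finpartition.mem_part_ofSetoid_iff_rel]
    exact eq_comm
  rw [← lintegral_biUnion_finset hdisj fun P _ => measurableSet_levelTuples P, hunion,
    Measure.restrict_univ]

variable {X : Type u} [MetricSpace X] [LocallyCompactSpace X] [SecondCountableTopology X]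
  [MeasurableSpace X] [BorelSpace X] {σ : Measure X} [SigmaFinite σ] [NullSingletonClass σ]
  {Pr : Measure (PointConfig X)}

/-- The expectation of an integral against a mixed product measure, as a sum over partitions of the
index set. -/
theorem IsPoissonMeasure.lintegral_pi_mixedMeasure (hPr : IsPoissonMeasure σ Pr) {S : Type}
    [Fintype S] [DecidableEq S] (ε : S → Fin 2) {F : PointConfig X × (S → X) → ℝ≥0∞}
    (hF : Measurable F) :
    ∫⁻ ω, ∫⁻ z, F (ω, z) ∂Measure.pi (fun s => mixedMeasure σ ω (ε s)) ∂Pr =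
      ∑ P ∈ mixedPartitions ε, ∫⁻ ω, ∫⁻ y in {y : P.parts → X | Function.Injective y},
        F (ω.adjoin ε (partitionPoint P y), partitionPoint P y) ∂Measure.pi (fun _ => σ) ∂Pr := by
  have hm : ∀ P : Finpartition (Finset.univ : Finset S), Measurable fun ω =>
      ∫⁻ z in levelTuples P X, F (ω, z)
        ∂Measure.pi (fun s => mixedMeasure σ ω (ε s)) := by
    intro P
    simp_rw [← lintegral_indicator (measurableSet_levelTuples P)]
    refine measurable_lintegral_pi_mixedMeasure' ε
      (G := fun p => (levelTuples P X).indicator (fun z => F (p.1, z)) p.2) ?_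
    exact hF.indicator (s := Prod.snd ⁻¹' levelTuples P X)
      (measurable_snd (measurableSet_levelTuples P))
  have hsum : ∀ ω : PointConfig X, ∫⁻ z, F (ω, z) ∂Measure.pi (fun s => mixedMeasure σ ω (ε s)) =
      ∑ P : Finpartition (Finset.univ : Finset S), ∫⁻ z in levelTuples P X, F (ω, z)
        ∂Measure.pi (fun s => mixedMeasure σ ω (ε s)) :=
    fun ω => lintegral_eq_sum_finpartition _ _
  simp_rw [hsum]
  rw [lintegral_finsetSum _ fun P _ => hm P]
  refine (Finset.sum_subset (Finset.subset_univ (mixedPartitions ε)) fun P _ hP => ?_).symm.trans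
    (Finset.sum_congr rfl fun P hP => ?_)
  · -- Two coordinates, one of them integrated against `σ`, coincide only on a null set.
    simp only [mixedPartitions, Finset.mem_filter, Finset.mem_univ, true_and, not_forall] at hP
    obtain ⟨B, hB, hcard, s, hs, hεs⟩ := hP
    obtain ⟨t, ht, hts⟩ := Finset.exists_mem_ne hcard s
    refine lintegral_eq_zero_of_ae_eq_zero (.of_forall fun ω => ?_)
    have hs0 : NullSingletonClass (mixedMeasure σ ω (ε s)) := by
      rw [mixedMeasure, if_neg hεs]
      infer_instance
    refine setLIntegral_measure_zero _ _ (measure_mono_null (fun z hz => ?_)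
      (pi_setOf_eq_null (fun s => mixedMeasure σ ω (ε s)) hts.symm))
    exact (hz s t).2 ((P.part_eq_of_mem hB hs).trans (P.part_eq_of_mem hB ht).symm)
  · simp only [mixedPartitions, Finset.mem_filter, Finset.mem_univ, true_and] at hP
    let f : S → P.parts := fun s => ⟨P.part s, P.part_mem.2 (Finset.mem_univ s)⟩
    have hf : Function.Surjective f := fun ⟨B, hB⟩ => by
      obtain ⟨s, hs⟩ := P.nonempty_of_mem_parts hB
      exact ⟨s, Subtype.ext (P.part_eq_of_mem hB hs)⟩
    have hfst : ∀ s t, f s = f t ↔ P.part s = P.part t := fun s t => Subtype.ext_iff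
    -- In a block with several elements `ε` is one, so `ε` descends to the set of blocks.
    let e : P.parts → Fin 2 := fun B => ε (Function.surjInv hf B)
    have hε1 : ∀ s t, s ≠ t → f s = f t → ε s = 1 := by
      intro s t hst h
      refine hP (P.part s) (f s).2 ?_ s (P.mem_part (Finset.mem_univ s))
      refine Finset.one_lt_card.2 ⟨s, P.mem_part (Finset.mem_univ s), t, ?_, hst⟩
      rw [(hfst s t).1 h]
      exact P.mem_part (Finset.mem_univ t)
    have he : ∀ s, e (f s) = ε s := by
      intro s
      have hinv : f (Function.surjInv hf (f s)) = f s := Function.surjInv_eq hf _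
      by_cases h : Function.surjInv hf (f s) = s
      · exact congrArg ε h
      · exact (hε1 _ _ h hinv).trans (hε1 _ _ (Ne.symm h) hinv.symm).symm
    have hadj : ∀ (ω : PointConfig X) (y : P.parts → X),
        ω.adjoin ε (partitionPoint P y) = ω.adjoin e y := by
      intro ω y
      ext x
      simp only [PointConfig.adjoin, PointConfig.unionFinite, Set.mem_union, Set.mem_image,
        Set.mem_ofPred_eq, hf.exists, he]
      rfl
    have hcomp : Measurable fun (y : P.parts → X) s => y (f s) := by fun_prop
    have h1 : ∀ ω : PointConfig X,
        ∫⁻ z in levelTuples P X, F (ω, z)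
          ∂Measure.pi (fun s => mixedMeasure σ ω (ε s)) =
        ∫⁻ y in {y | Function.Injective y}, F (ω, fun s => y (f s))
          ∂Measure.pi (fun B => mixedMeasure σ ω (e B)) := by
      intro ω
      rw [← setLIntegral_pi_mixedMeasure_fibers ω hf e (fun s t hst h => by
        rw [he]; exact hε1 s t hst h) (H := fun z => F (ω, z)) (by fun_prop)]
      simp_rw [he, hfst]
      rfl
    simp_rw [h1, hadj]
    exact hPr.mecke_mixed_fintype e (G := fun p => F (p.1, fun s => p.2 (f s)))
      (hF.comp (measurable_fst.prodMk (hcomp.comp measurable_snd)))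

end Partition

theorem mainTheorem3 {X : Type*} [MetricSpace X] [LocallyCompactSpace X]
    [TopologicalSpace.SeparableSpace X] [MeasurableSpace X] [BorelSpace X]
    (σ : Measure X) [SigmaFinite σ] [NullSingletonClass σ]
    (Pr : Measure (PointConfig X)) (hPr : IsPoissonMeasure σ Pr)
    (l : ℕ) (hl : 1 ≤ l) (r n : Fin l → ℕ) (hr : ∀ α, 1 ≤ r α) (hn : ∀ α, 1 ≤ n α)
    (f₀ : PointConfig X → ℝ≥0) (hf₀ : Measurable f₀)
    (f : (α : Fin l) → (Fin (r α) → X) → PointConfig X → ℝ≥0) (hf : ∀ α, IsProcess (f α))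
    (ε : (α : Fin l) → Fin (r α) → Fin 2) :
    ∫⁻ ω, (f₀ ω : ℝ≥0∞) *
        ∏ α : Fin l, (∫⁻ y, (f α y ω : ℝ≥0∞) ∂(mixedProd σ ω (ε α))) ^ n α ∂Pr =
      ∑ P ∈ mixedPartitions (momentPattern (n := n) ε),
        ∫⁻ ω, ∫⁻ y in {y : P.parts → X | Function.Injective y},
          (f₀ (ω.adjoin (momentPattern ε) (partitionPoint P y)) : ℝ≥0∞) *
            ∏ α : Fin l, ∏ γ : Fin (n α),
              (f α (fun β => partitionPoint P y ⟨α, β, γ⟩)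
                (ω.adjoin (momentPattern ε) (partitionPoint P y)) : ℝ≥0∞)
          ∂(Measure.pi (fun _ : P.parts => σ)) ∂Pr := by
  have : SecondCountableTopology X := UniformSpace.secondCountable_of_separable X
  have hF : Measurable fun p : PointConfig X × (MomentIndex r n → X) =>
      (f₀ p.1 : ℝ≥0∞) *
        ∏ α : Fin l, ∏ γ : Fin (n α), (f α (fun β => p.2 ⟨α, β, γ⟩) p.1 : ℝ≥0∞) := by
    refine (hf₀.comp measurable_fst).coe_nnreal_ennreal.mul ?_
    refine Finset.measurable_prod _ fun α _ => Finset.measurable_prod _ fun γ _ => ?_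
    refine Measurable.coe_nnreal_ennreal ((hf α).comp
      (f := fun p : PointConfig X × (MomentIndex r n → X) => (fun β => p.2 ⟨α, β, γ⟩, p.1)) ?_)
    fun_prop
  rw [← hPr.lintegral_pi_mixedMeasure (momentPattern (n := n) ε) hF]
  refine lintegral_congr fun ω => ?_
  -- The blocks `S_{α,γ}` partition the index set, and the factors depend on disjoint blocks.
  let φ : (Σ i : (Σ α : Fin l, Fin (n α)), Fin (r i.1)) ≃ MomentIndex r n :=
    { toFun := fun p => ⟨p.1.1, p.2, p.1.2⟩
      invFun := fun s => ⟨⟨s.1, s.2.2⟩, s.2.1⟩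
      left_inv := fun _ => rfl
      right_inv := fun _ => rfl }
  have hfω : ∀ α, Measurable fun y => (f α y ω : ℝ≥0∞) := fun α =>
    ((hf α).comp measurable_prodMk_right).coe_nnreal_ennreal
  have hprod : Measurable fun z : MomentIndex r n → X =>
      ∏ α : Fin l, ∏ γ : Fin (n α), (f α (fun β => z ⟨α, β, γ⟩) ω : ℝ≥0∞) :=
    Finset.measurable_prod _ fun α _ => Finset.measurable_prod _ fun γ _ =>
      (hfω α).comp (by fun_prop)
  simp only
  rw [lintegral_const_mul _ hprod]
  congr 1
  rw [← map_pi_pi φ, lintegral_map hprod (by fun_prop)]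
  have hσ : ∀ i : (Σ α : Fin l, Fin (n α)), SigmaFinite (mixedProd σ ω (ε i.1)) := fun i => by
    unfold mixedProd
    infer_instance
  have hpow : ∏ α : Fin l, (∫⁻ y, (f α y ω : ℝ≥0∞) ∂(mixedProd σ ω (ε α))) ^ n α =
      ∏ i : (Σ α : Fin l, Fin (n α)), ∫⁻ y, (f i.1 y ω : ℝ≥0∞) ∂(mixedProd σ ω (ε i.1)) := by
    rw [Fintype.prod_sigma]
    exact Finset.prod_congr rfl fun α _ => (Fin.prod_const (n α) _).symm
  rw [hpow, ← lintegral_pi_prod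
    (fun i : (Σ α : Fin l, Fin (n α)) => mixedProd σ ω (ε i.1)) (fun i => hfω i.1)]
  refine lintegral_congr fun w => ?_
  rw [Fintype.prod_sigma]
  rfl
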